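/- Let $A$ be a commutative ring with unit, let $r,p,n,d\ge 0$ be integers with $n\le d$, let $S=A[X_0,\dots,X_r]$ with its standard grading, and let $M=S^{\oplus p}$ with the grading $M_t=(S_t)^{\oplus p}$. Let $N\subseteq M$ be a graded $S$-submodule generated in degrees at most $d$, and let $Q=M/N$ with its induced grading, whose component $Q_t$ is an $A$-module for each $t$. If the $A$-modules $Q_d$ and $Q_{d+1}$ are locally free of rank $n$, then the $A$-module $Q_t$ is locally free of rank $n$ for every $t\ge d$. Here an $A$-module $P$ is called locally free of rank $n$ if every prime ideal of $A$ has some $f\in A$ not contained in it such that $P_f$ is a free $A_f$-module of rank $n$. -/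

import Mathlib

/-- An `A`-module `P` is locally free of rank `n` if every point of `Spec A` has a basic open
neighbourhood `D(f)` on which `P` becomes free of rank `n`, that is `P_f ≅ (A_f)ⁿ`. -/
def IsLocallyFreeOfRank (A : Type*) [CommRing A] (P : Type*) [AddCommGroup P] [Module A P]
    (n : ℕ) : Prop :=
  ∀ 𝔭 : PrimeSpectrum A, ∃ f : A, f ∉ 𝔭.asIdeal ∧
    Nonempty (LocalizedModule (Submonoid.powers f) P ≃ₗ[Localization.Away f]
      (Fin n → Localization.Away f))

/-- The polynomial ring `S = A[X_0, …, X_r]`. -/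
abbrev PolyRing (A : Type*) [CommRing A] (r : ℕ) : Type _ := MvPolynomial (Fin (r + 1)) A

/-- The free module `M = S^p` over `S = A[X_0, …, X_r]`. -/
abbrev FreeMod (A : Type*) [CommRing A] (r p : ℕ) : Type _ := Fin p → PolyRing A r

/-- The graded component `M_t` of `M = S^p`, as an `A`-submodule: the tuples all of whose entries
are homogeneous of degree `t`. -/
noncomputable def freeModComponent (A : Type*) [CommRing A] (r p t : ℕ) : Submodule A (FreeMod A r p) :=
  Submodule.pi Set.univ fun _ => MvPolynomial.homogeneousSubmodule (Fin (r + 1)) A t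

/-- An `S`-submodule `N` of `M = S^p` is graded if it contains the degree `t` component of each of
its elements, for every `t`. -/
def IsGradedSubmodule {A : Type*} [CommRing A] {r p : ℕ}
    (N : Submodule (PolyRing A r) (FreeMod A r p)) : Prop :=
  ∀ m ∈ N, ∀ t : ℕ, (fun i => MvPolynomial.homogeneousComponent t (m i)) ∈ N

/-- An `S`-submodule `N` of `M = S^p` is generated in degrees at most `d` if it is generated, as an
`S`-module, by its homogeneous elements of degree at most `d`. -/
def IsGeneratedInDegreesLE {A : Type*} [CommRing A] {r p : ℕ}
    (N : Submodule (PolyRing A r) (FreeMod A r p)) (d : ℕ) : Prop :=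
  Submodule.span (PolyRing A r) {m | m ∈ N ∧ ∃ t ≤ d, m ∈ freeModComponent A r p t} = N

/-- The graded component `Q_t` of `Q = M / N`, as an `A`-submodule of `Q`: the image of `M_t`. -/
noncomputable def quotientComponent {A : Type*} [CommRing A] {r p : ℕ}
    (N : Submodule (PolyRing A r) (FreeMod A r p)) (t : ℕ) :
    Submodule A (FreeMod A r p ⧸ N) :=
  (freeModComponent A r p t).map (N.mkQ.restrictScalars A)

/-!
Everything is local on `Spec A`, and by descent along the flat local homomorphisms
`A_𝔭 → A[T]_{𝔭A[T]}` one may assume that `A` is local with infinite residue field.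

If `d = 0` then `n = 0` and `Q = 0`. Otherwise there is a linear form `ℓ` with `ℓ Q_{d-1} = Q_d`. By
Nakayama it is enough to find it over the residue field, where it exists because `dim Q_d = n ≤ d`;
this instance of Green's hyperplane restriction theorem is `IsGradedSystem.exists_linearForm_surjective`. As `Q` is generated
in degree zero, `ℓ` stays surjective in higher degrees, and `ℓ : Q_d → Q_{d+1}` is even bijective,
being a surjection between free modules of the same rank. Now consider the operators `X_i ℓ⁻¹` on
`Q_{d+1}`. Since `Q_d = ℓ Q_{d-1}`, they satisfy `X_i ℓ⁻¹ X_j = X_j ℓ⁻¹ X_i` on `Q_d`. As `N` has no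
generators in degree `d + 2`, the only relations between the products `X_i q ∈ Q_{d+2}` with
`q ∈ Q_{d+1}` are the Koszul relations, so these operators define a map `Q_{d+2} → Q_{d+1}`, which is
a left inverse of `ℓ` (`IsGradedSystem.linearForm_bijective_of_isKoszulPresented`). Hence
`ℓ : Q_{d+1} → Q_{d+2}` is bijective as well, and the theorem follows by induction on the degree.

To make base change painless, the graded module `Q` is replaced by the sequence of its components
together with the multiplications by the variables (`IsGradedSystem`), and the absence of new
relations is expressed by a mapping property (`IsKoszulPresented`) that is stable under base change.
-/

open TensorProduct

universe u v

/-! ### Families of modules with commuting linear operators of degree one -/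

/-- `Q₀, Q₁, …` is a graded module generated in degree zero over a polynomial ring with variables
indexed by `ι`, given by its components and the multiplications `X i t : Q t → Q (t + 1)` by the
variables. -/
structure IsGradedSystem {A ι : Type*} [CommRing A] [Fintype ι] {Q : ℕ → Type*}
    [∀ t, AddCommGroup (Q t)] [∀ t, Module A (Q t)]
    (X : ι → ∀ t, Q t →ₗ[A] Q (t + 1)) : Prop where
  comm : ∀ i j t q, X i (t + 1) (X j t q) = X j (t + 1) (X i t q)
  gen : ∀ t (q' : Q (t + 1)), ∃ q : ι → Q t, ∑ i, X i t (q i) = q'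

/-- The component `Q (s + 2)` is the cokernel of the Koszul map
`⋀² A^ι ⊗ Q s → A^ι ⊗ Q (s + 1)`, expressed by the mapping property of that cokernel: the module
has no relations in degree `s + 2` besides those forced by the relations in lower degrees. -/
def IsKoszulPresented {A : Type u} {ι : Type*} [CommRing A] {Q : ℕ → Type u}
    [∀ t, AddCommGroup (Q t)] [∀ t, Module A (Q t)]
    (X : ι → ∀ t, Q t →ₗ[A] Q (t + 1)) (s : ℕ) : Prop :=
  ∀ (V : Type u) [AddCommGroup V] [Module A V] (ψ : ι → Q (s + 1) →ₗ[A] V),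
    (∀ i j q, ψ i (X j s q) = ψ j (X i s q)) →
      ∃ φ : Q (s + 2) →ₗ[A] V, ∀ i q, φ (X i (s + 1) q) = ψ i q

/-- Multiplication by the linear form `∑ i, c i X_i`. -/
def linearForm {A ι : Type*} [CommRing A] [Fintype ι] {Q : ℕ → Type*}
    [∀ t, AddCommGroup (Q t)] [∀ t, Module A (Q t)]
    (X : ι → ∀ t, Q t →ₗ[A] Q (t + 1)) (c : ι → A) (t : ℕ) : Q t →ₗ[A] Q (t + 1) :=
  ∑ i, c i • X i t

section System

variable {A ι : Type*} [CommRing A] [Fintype ι] {Q : ℕ → Type*}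
  [∀ t, AddCommGroup (Q t)] [∀ t, Module A (Q t)] {X : ι → ∀ t, Q t →ₗ[A] Q (t + 1)}

lemma linearForm_apply (c : ι → A) (t : ℕ) (q : Q t) :
    linearForm X c t q = ∑ i, c i • X i t q := by
  simp [linearForm]

lemma linearForm_single [DecidableEq ι] (i : ι) (t : ℕ) :
    linearForm X (Pi.single i (1 : A)) t = X i t := by
  ext q
  rw [linearForm_apply, Finset.sum_eq_single i]
  · simp
  · intro j _ hj
    simp [hj]
  · simp

lemma linearForm_add_smul (c c' : ι → A) (a : A) (t : ℕ) :
    linearForm X (c + a • c') t = linearForm X c t + a • linearForm X c' t := by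
  simp [linearForm, add_smul, mul_smul, Finset.sum_add_distrib, Finset.smul_sum]

lemma IsGradedSystem.linearForm_comm (h : IsGradedSystem X) (c : ι → A) (i : ι) (t : ℕ) (q : Q t) :
    X i (t + 1) (linearForm X c t q) = linearForm X c (t + 1) (X i t q) := by
  simp [linearForm_apply, h.comm i]

lemma IsGradedSystem.range_linearForm_eq_top_of_forall (h : IsGradedSystem X) {t : ℕ}
    {R : Submodule A (Q (t + 1))} (hR : ∀ i, LinearMap.range (X i t) ≤ R) : R = ⊤ := by
  refine Submodule.eq_top_iff'.2 fun q' => ?_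
  obtain ⟨q, rfl⟩ := h.gen t q'
  exact Submodule.sum_mem _ fun i _ => hR i ⟨q i, rfl⟩

lemma IsGradedSystem.linearForm_surjective_succ (h : IsGradedSystem X) {c : ι → A} {t : ℕ}
    (hc : Function.Surjective (linearForm X c t)) :
    Function.Surjective (linearForm X c (t + 1)) := by
  rw [← LinearMap.range_eq_top]
  refine h.range_linearForm_eq_top_of_forall fun i => ?_
  rintro _ ⟨q, rfl⟩
  obtain ⟨q, rfl⟩ := hc q
  exact ⟨X i t q, (h.linearForm_comm c i t q).symm⟩

lemma IsGradedSystem.subsingleton_of_le (h : IsGradedSystem X) {d t : ℕ} (hdt : d ≤ t)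
    (hd : Subsingleton (Q d)) : Subsingleton (Q t) := by
  induction t, hdt using Nat.le_induction with
  | base => exact hd
  | succ t _ ih =>
    refine subsingleton_of_forall_eq 0 fun q' => ?_
    obtain ⟨q, rfl⟩ := h.gen t q'
    exact Finset.sum_eq_zero fun i _ => by rw [Subsingleton.elim (q i) 0, map_zero]

lemma IsGradedSystem.baseChange (B : Type*) [CommRing B] [Algebra A B] (h : IsGradedSystem X) :
    IsGradedSystem fun i t => (X i t).baseChange B where
  comm i j t q := by
    induction q with
    | zero => simp
    | add a b ha hb => simp only [map_add, ha, hb]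
    | tmul b q => simp [h.comm i j]
  gen t q' := by
    induction q' with
    | zero => exact ⟨0, by simp⟩
    | add a b ha hb =>
      obtain ⟨x, rfl⟩ := ha
      obtain ⟨y, rfl⟩ := hb
      exact ⟨x + y, by simp [Finset.sum_add_distrib]⟩
    | tmul b q' =>
      obtain ⟨q, rfl⟩ := h.gen t q'
      exact ⟨fun i => b ⊗ₜ q i, by simp [tmul_sum]⟩

/-- Multiplication by the variable `X_i` on the images of multiplication by a linear form. -/
def IsGradedSystem.rangeMap (h : IsGradedSystem X) (c : ι → A) (i : ι) (t : ℕ) :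
    LinearMap.range (linearForm X c t) →ₗ[A] LinearMap.range (linearForm X c (t + 1)) :=
  (X i (t + 1)).restrict (by
    rintro _ ⟨q, rfl⟩
    exact ⟨X i t q, (h.linearForm_comm c i t q).symm⟩)

lemma IsGradedSystem.rangeMap_isGradedSystem (h : IsGradedSystem X) (c : ι → A) :
    IsGradedSystem (Q := fun t => LinearMap.range (linearForm X c t)) (h.rangeMap c) where
  comm i j t q := Subtype.ext (h.comm i j (t + 1) q)
  gen t := by
    rintro ⟨_, q', rfl⟩
    obtain ⟨q, rfl⟩ := h.gen t q'
    refine ⟨fun i => ⟨_, q i, rfl⟩, Subtype.ext ?_⟩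
    simp [rangeMap, h.linearForm_comm]

end System

lemma IsKoszulPresented.baseChange {A : Type u} {ι : Type*} [CommRing A] {Q : ℕ → Type u}
    [∀ t, AddCommGroup (Q t)] [∀ t, Module A (Q t)]
    {X : ι → ∀ t, Q t →ₗ[A] Q (t + 1)} {s : ℕ} (B : Type u) [CommRing B] [Algebra A B]
    (h : IsKoszulPresented X s) : IsKoszulPresented (fun i t => (X i t).baseChange B) s := by
  intro V _ _ ψ hψ
  let _ : Module A V := Module.compHom V (algebraMap A B)
  have : IsScalarTower A B V := IsScalarTower.of_algebraMap_smul fun _ _ => rfl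
  obtain ⟨φ, hφ⟩ := h V (fun i => (ψ i).restrictScalars A ∘ₗ TensorProduct.mk A B _ 1)
    fun i j q => by simpa using hψ i j (1 ⊗ₜ q)
  refine ⟨φ.liftBaseChange B, fun i q => ?_⟩
  induction q with
  | zero => simp
  | add a b ha hb => simp only [map_add, ha, hb]
  | tmul b q =>
    have : b ⊗ₜ[A] q = b • (1 : B) ⊗ₜ[A] q := by simp [smul_tmul']
    simp [hφ, this]

/-! ### A linear form acting surjectively, over an infinite field -/

lemma exists_ne_zero_surjective_add_smul {k V W : Type*} [Field k] [Infinite k] [AddCommGroup V]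
    [Module k V] [AddCommGroup W] [Module k W] [FiniteDimensional k W] {f : V →ₗ[k] W}
    (hf : Function.Surjective f) (g : V →ₗ[k] W) :
    ∃ a : k, a ≠ 0 ∧ Function.Surjective (f + a • g) := by
  obtain ⟨h, hh⟩ := f.exists_rightInverse_of_surjective (LinearMap.range_eq_top.2 hf)
  obtain ⟨b, hb⟩ := ((Module.End.finite_hasEigenvalue (g ∘ₗ h)).union (Set.finite_singleton 0)).exists_notMem
  simp only [Set.mem_union, Set.mem_ofPred_eq, Set.mem_singleton_iff, not_or] at hb
  -- `f + a g` is onto as soon as `(f + a g) h = 1 + a g h` is, that is if `-1/a` is not an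
  -- eigenvalue of `g h`
  refine ⟨-b⁻¹, by simpa using hb.2, ?_⟩
  have hcomp : ∀ w, (f + (-b⁻¹) • g) (h w) = w - b⁻¹ • g (h w) := fun w => by
    have := LinearMap.congr_fun hh w
    simp only [LinearMap.comp_apply, LinearMap.id_apply] at this
    simp [this, sub_eq_add_neg]
  have hinj : Function.Injective ((f + (-b⁻¹) • g) ∘ₗ h) := by
    rw [← LinearMap.ker_eq_bot, LinearMap.ker_eq_bot']
    intro w hw
    by_contra hw0
    refine hb.1 (Module.End.hasEigenvalue_of_hasEigenvector (x := w) ?_)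
    refine Module.End.hasEigenvector_iff.2 ⟨Module.End.mem_eigenspace_iff.2 ?_, hw0⟩
    rw [LinearMap.comp_apply, hcomp, sub_eq_zero] at hw
    nth_rewrite 2 [hw]
    simp [smul_smul, hb.2]
  exact Function.Surjective.of_comp (LinearMap.injective_iff_surjective.1 hinj)

/-- A form of Green's hyperplane restriction theorem: if the component of degree `d + 1` of a graded
module generated in degree zero has dimension at most `d + 1`, then some linear form maps the
component of degree `d` onto it.

Let `ℓ` be a linear form whose image `ℓ U_d` has maximal dimension. If it is not everything, then
the induction hypothesis applies to the graded module `ℓ U`, whose component `ℓ U_d` has smaller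
dimension, and yields forms `ℓ'` with `ℓ U_d = ℓ' ℓ U_{d-1} ⊆ ℓ' U_d`. By maximality `ℓ' U_d = ℓ U_d`
for these `ℓ'`; but they span the space of all linear forms, so that `U_{d+1} = ℓ U_d`. -/
lemma IsGradedSystem.exists_linearForm_surjective {k ι : Type*} [Field k] [Infinite k] [Fintype ι]
    (d : ℕ) {U : ℕ → Type u} [∀ t, AddCommGroup (U t)] [∀ t, Module k (U t)]
    [∀ t, FiniteDimensional k (U t)] {X : ι → ∀ t, U t →ₗ[k] U (t + 1)} (h : IsGradedSystem X)
    (hd : Module.finrank k (U (d + 1)) ≤ d + 1) :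
    ∃ c, Function.Surjective (linearForm X c d) := by
  classical
  induction d generalizing U with
  | zero =>
    by_contra! hns
    -- all images are proper subspaces of a space of dimension at most one
    have hzero (c : ι → k) : LinearMap.range (linearForm X c 0) = ⊥ := by
      have := Submodule.finrank_lt fun hc => hns c (LinearMap.range_eq_top.1 hc)
      exact Submodule.finrank_eq_zero.1 (by omega)
    refine hns 0 (LinearMap.range_eq_top.1 (h.range_linearForm_eq_top_of_forall fun i => ?_))
    rw [← linearForm_single (X := X) i, hzero]
    exact bot_le
  | succ d ih =>
    by_contra! hns
    have hne (c : ι → k) : LinearMap.range (linearForm X c (d + 1)) ≠ ⊤ :=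
      fun hc => hns c (LinearMap.range_eq_top.1 hc)
    obtain ⟨c, hmax⟩ : ∃ c : ι → k, ∀ c', Module.finrank k (LinearMap.range (linearForm X c' (d + 1)))
        ≤ Module.finrank k (LinearMap.range (linearForm X c (d + 1))) := by
      obtain ⟨m, ⟨c, rfl⟩, hm⟩ := Set.exists_max_image
        (Set.range fun c : ι → k => Module.finrank k (LinearMap.range (linearForm X c (d + 1)))) id
        ((Set.finite_le_nat (d + 2)).subset (by
          rintro _ ⟨c, rfl⟩
          exact (Submodule.finrank_le _).trans hd)) ⟨_, 0, rfl⟩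
      exact ⟨c, fun c' => hm _ ⟨c', rfl⟩⟩
    have hlt := Submodule.finrank_lt (hne c)
    obtain ⟨c₀, hc₀⟩ := ih (h.rangeMap_isGradedSystem c) (by omega)
    -- a form which is onto in the system of images has the same image as the maximal one
    have key (c' : ι → k) (hc' : Function.Surjective (linearForm
        (Q := fun t => LinearMap.range (linearForm X c t)) (h.rangeMap c) c' d)) :
        LinearMap.range (linearForm X c' (d + 1)) = LinearMap.range (linearForm X c (d + 1)) := by
      refine (Submodule.eq_of_le_of_finrank_le (fun y hy => ?_) (hmax c')).symm
      obtain ⟨x, hx⟩ := hc' ⟨y, hy⟩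
      refine ⟨x, ?_⟩
      have := congrArg Subtype.val hx
      rw [linearForm_apply] at this ⊢
      simpa [IsGradedSystem.rangeMap] using this
    refine hne c (h.range_linearForm_eq_top_of_forall fun i => ?_)
    obtain ⟨a, ha, hsurj⟩ := exists_ne_zero_surjective_add_smul hc₀
      (linearForm (Q := fun t => LinearMap.range (linearForm X c t)) (h.rangeMap c)
        (Pi.single i (1 : k)) d)
    rw [← linearForm_add_smul] at hsurj
    rintro _ ⟨u, rfl⟩
    have h₀ : linearForm X c₀ (d + 1) u ∈ LinearMap.range (linearForm X c (d + 1)) :=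
      key _ hc₀ ▸ ⟨u, rfl⟩
    have h₁ : linearForm X (c₀ + a • Pi.single i (1 : k)) (d + 1) u ∈
        LinearMap.range (linearForm X c (d + 1)) := key _ hsurj ▸ ⟨u, rfl⟩
    rw [linearForm_add_smul, LinearMap.add_apply, Submodule.add_mem_iff_right _ h₀,
      LinearMap.smul_apply, Submodule.smul_mem_iff _ ha, linearForm_single] at h₁
    exact h₁

/-! ### Persistence over a local ring with infinite residue field -/

/-- If a linear form `ℓ` is onto from degree `s` and bijective from degree `s + 1`, then it is
bijective from degree `s + 2`: the maps `X_i ℓ⁻¹ : Q (s + 2) → Q (s + 2)` satisfy the compatibility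
conditions that define a map out of `Q (s + 3)`, and this map is inverse to `ℓ`. -/
lemma IsGradedSystem.linearForm_bijective_of_isKoszulPresented {A : Type u} {ι : Type*} [CommRing A]
    [Fintype ι] {Q : ℕ → Type u} [∀ t, AddCommGroup (Q t)] [∀ t, Module A (Q t)]
    {X : ι → ∀ t, Q t →ₗ[A] Q (t + 1)} (h : IsGradedSystem X) {s : ℕ}
    (hK : IsKoszulPresented X (s + 1)) {c : ι → A} (hs : Function.Surjective (linearForm X c s))
    (hb : Function.Bijective (linearForm X c (s + 1))) :
    Function.Bijective (linearForm X c (s + 2)) := by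
  let e := LinearEquiv.ofBijective _ hb
  have he (q) : e.symm (linearForm X c (s + 1) q) = q := e.symm_apply_apply q
  have he' (q) : linearForm X c (s + 1) (e.symm q) = q := e.apply_symm_apply q
  obtain ⟨φ, hφ⟩ := hK (Q (s + 2)) (fun i => X i (s + 1) ∘ₗ e.symm.toLinearMap) fun i j q => by
    obtain ⟨q, rfl⟩ := hs q
    simp [h.linearForm_comm, he, h.comm i j]
  refine ⟨Function.LeftInverse.injective (g := φ) fun q => ?_,
    h.linearForm_surjective_succ (h.linearForm_surjective_succ hs)⟩
  rw [linearForm_apply]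
  simp only [map_sum, map_smul, hφ, LinearMap.comp_apply, LinearEquiv.coe_coe]
  rw [← linearForm_apply, he']

lemma baseChange_linearForm {A B ι : Type*} [CommRing A] [CommRing B] [Algebra A B] [Fintype ι]
    {Q : ℕ → Type*} [∀ t, AddCommGroup (Q t)] [∀ t, Module A (Q t)]
    (X : ι → ∀ t, Q t →ₗ[A] Q (t + 1)) (c : ι → A) (t : ℕ) :
    (linearForm X c t).baseChange B =
      linearForm (fun i t => (X i t).baseChange B) (fun i => algebraMap A B (c i)) t := by
  ext q
  simp [linearForm_apply, tmul_sum, TensorProduct.tmul_smul]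

lemma surjective_of_baseChange_residueField {R M N : Type*} [CommRing R] [IsLocalRing R]
    [AddCommGroup M] [Module R M] [AddCommGroup N] [Module R N] [Module.Finite R N] (f : M →ₗ[R] N)
    (hf : Function.Surjective (f.baseChange (IsLocalRing.ResidueField R))) :
    Function.Surjective f := by
  rw [← LinearMap.range_eq_top, ← IsLocalRing.map_tensorProduct_mk_eq_top, eq_top_iff]
  rintro y -
  obtain ⟨x, rfl⟩ := hf y
  obtain ⟨m, rfl⟩ := TensorProduct.mk_surjective R M (IsLocalRing.ResidueField R)
    IsLocalRing.residue_surjective x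
  exact ⟨f m, ⟨m, rfl⟩, by simp⟩

lemma IsGradedSystem.nonempty_linearEquiv_of_isLocalRing {R : Type u} {ι : Type*} [CommRing R]
    [IsLocalRing R] [Infinite (IsLocalRing.ResidueField R)] [Fintype ι] {Q : ℕ → Type u}
    [∀ t, AddCommGroup (Q t)] [∀ t, Module R (Q t)] [∀ t, Module.Finite R (Q t)]
    {X : ι → ∀ t, Q t →ₗ[R] Q (t + 1)} (h : IsGradedSystem X) {s n : ℕ}
    (hK : IsKoszulPresented X (s + 1)) (hn : n ≤ s + 1)
    (h₁ : Nonempty (Q (s + 1) ≃ₗ[R] (Fin n → R))) (h₂ : Nonempty (Q (s + 2) ≃ₗ[R] (Fin n → R))) :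
    Nonempty (Q (s + 3) ≃ₗ[R] (Fin n → R)) := by
  obtain ⟨e₁⟩ := h₁
  obtain ⟨e₂⟩ := h₂
  obtain ⟨c, hc⟩ := (h.baseChange (IsLocalRing.ResidueField R)).exists_linearForm_surjective s (by
    have := Module.Free.of_equiv e₁.symm
    rw [Module.finrank_baseChange, e₁.finrank_eq, Module.finrank_fin_fun]
    exact hn)
  choose c' hc' using fun i => IsLocalRing.residue_surjective (c i)
  have hs : Function.Surjective (linearForm X c' s) := by
    apply surjective_of_baseChange_residueField
    rw [baseChange_linearForm]
    simpa [hc'] using hc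
  have hb : Function.Bijective (linearForm X c' (s + 1)) := by
    have hsurj := h.linearForm_surjective_succ hs
    let e := e₂.trans e₁.symm
    have := Module.Finite.of_surjective _ e₁.symm.surjective
    exact ⟨Function.Injective.of_comp (f := e) (OrzechProperty.injective_of_surjective_endomorphism
      (e.toLinearMap ∘ₗ linearForm X c' (s + 1)) (e.surjective.comp hsurj)), hsurj⟩
  exact ⟨(LinearEquiv.ofBijective _
    (h.linearForm_bijective_of_isKoszulPresented hK hs hb)).symm.trans e₂⟩

/-! ### Locally free modules, and descent from an extension with infinite residue fields -/

lemma IsLocallyFreeOfRank.flat {A P : Type*} [CommRing A] [AddCommGroup P] [Module A P] {n : ℕ}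
    (h : IsLocallyFreeOfRank A P n) : Module.Flat A P := by
  choose f hf e using h
  refine Module.flat_of_localized_span A P (Set.range f) ?_ ?_
  · by_contra hne
    obtain ⟨m, hm, hle⟩ := Ideal.exists_le_maximal _ hne
    exact hf ⟨m, hm.isPrime⟩ (hle (Ideal.subset_span ⟨_, rfl⟩))
  · rintro ⟨_, p, rfl⟩
    obtain ⟨e⟩ := e p
    have := Module.Free.of_equiv e.symm
    exact Module.Flat.trans A (Localization.Away (f p)) (LocalizedModule.Away (f p) P)

lemma IsLocallyFreeOfRank.rankAtStalk_eq {A P : Type*} [CommRing A] [AddCommGroup P] [Module A P]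
    [Module.Finite A P] {n : ℕ} (h : IsLocallyFreeOfRank A P n) (p : PrimeSpectrum A) :
    Module.rankAtStalk P p = n := by
  have := h.flat
  obtain ⟨f, hf, ⟨e⟩⟩ := h p
  obtain ⟨q, rfl⟩ : p ∈ Set.range (PrimeSpectrum.comap (algebraMap A (Localization.Away f))) := by
    rw [PrimeSpectrum.localization_away_comap_range (Localization.Away f) f]
    exact hf
  have := Module.Free.of_equiv e.symm
  have : Nontrivial (Localization.Away f) := q.nontrivial
  rw [← Module.rankAtStalk_isBaseChange (LocalizedModule.isBaseChange (Submonoid.powers f) P),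
    Module.rankAtStalk_eq_finrank_of_free, Pi.natCast_apply, e.finrank_eq, Module.finrank_fin_fun]
  rfl

lemma isLocallyFreeOfRank_of_flat {A P : Type*} [CommRing A] [AddCommGroup P] [Module A P]
    [Module.Finite A P] [Module.Flat A P] {n : ℕ} (h : ∀ p, Module.rankAtStalk (R := A) P p = n) :
    IsLocallyFreeOfRank A P n := by
  intro p
  obtain ⟨f, hf, hfree⟩ := Module.Free.away_of_finite_of_flat_of_rankAtStalk_constant P p.asIdeal
    fun m _ => (h _).trans (h _).symm
  obtain ⟨q, rfl⟩ : p ∈ Set.range (PrimeSpectrum.comap (algebraMap A (Localization.Away f))) := by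
    rw [PrimeSpectrum.localization_away_comap_range (Localization.Away f) f]
    exact hf
  have : Nontrivial (Localization.Away f) := q.nontrivial
  have hrank := Module.rankAtStalk_isBaseChange
    (LocalizedModule.isBaseChange (Submonoid.powers f) P) q
  rw [h, Module.rankAtStalk_eq_finrank_of_free] at hrank
  exact ⟨f, hf, ⟨(Module.finBasisOfFinrankEq _ _ hrank).equivFun⟩⟩

lemma nonempty_linearEquiv_baseChange {A P : Type*} (B : Type*) [CommRing A] [AddCommGroup P]
    [Module A P] [Module.Finite A P] [CommRing B] [IsLocalRing B] [Algebra A B] {n : ℕ}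
    (h : IsLocallyFreeOfRank A P n) : Nonempty (B ⊗[A] P ≃ₗ[B] (Fin n → B)) := by
  have := h.flat
  have : Module.Free B (B ⊗[A] P) := Module.free_of_flat_of_isLocalRing
  have hrank := Module.rankAtStalk_baseChange (R := A) (M := P) (IsLocalRing.closedPoint B)
  rw [h.rankAtStalk_eq, Module.rankAtStalk_eq_finrank_of_free] at hrank
  exact ⟨(Module.finBasisOfFinrankEq _ _ hrank).equivFun⟩

/-- Local freeness of rank `n` may be checked after base change to local rings `B` that are flat
over `A` and dominate the local rings of `A`. -/
lemma isLocallyFreeOfRank_of_baseChange {A : Type u} {P : Type v} [CommRing A] [AddCommGroup P]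
    [Module A P] [Module.Finite A P] {n : ℕ} {C : Type u} [CommRing C] [Algebra A C]
    [Module.Flat A C] (P' : Ideal A → Ideal C)
    (hP' : ∀ (p : Ideal A) [p.IsPrime], (P' p).IsPrime)
    (hover : ∀ (p : Ideal A) [p.IsPrime], (P' p).LiesOver p)
    (h : ∀ (p : Ideal A) [p.IsPrime], have := hP' p
      Nonempty (Localization.AtPrime (P' p) ⊗[A] P ≃ₗ[Localization.AtPrime (P' p)]
        (Fin n → Localization.AtPrime (P' p)))) :
    IsLocallyFreeOfRank A P n := by
  have hflat : Module.Flat A P := by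
    refine Module.flat_of_localized_maximal P fun p hp => ?_
    have := hP' p
    have := hover p
    let := Localization.AtPrime.algebraOfLiesOver p (P' p)
    obtain ⟨e⟩ := h p
    have : IsLocalHom (algebraMap (Localization.AtPrime p) (Localization.AtPrime (P' p))) :=
      Localization.isLocalHom_localRingHom _ _ _ _
    have := Module.FaithfullyFlat.of_flat_of_isLocalHom
      (A := Localization.AtPrime p) (B := Localization.AtPrime (P' p))
    have := Module.Free.of_equiv ((AlgebraTensorModule.cancelBaseChange A (Localization.AtPrime p)
      (Localization.AtPrime (P' p)) (Localization.AtPrime (P' p)) P).trans e).symm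
    have := Module.Flat.of_flat_tensorProduct (Localization.AtPrime p)
      (Localization.AtPrime p ⊗[A] P) (Localization.AtPrime (P' p))
    have := Module.Flat.trans A (Localization.AtPrime p) (Localization.AtPrime p ⊗[A] P)
    exact Module.Flat.of_linearEquiv
      ((LocalizedModule.equivTensorProduct p.primeCompl P).restrictScalars A)
  refine isLocallyFreeOfRank_of_flat fun p => ?_
  have := hP' p.asIdeal
  have hov := hover p.asIdeal
  obtain ⟨e⟩ := h p.asIdeal
  have := Module.Free.of_equiv e.symm
  have hrank := Module.rankAtStalk_baseChange (R := A) (M := P)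
    (IsLocalRing.closedPoint (Localization.AtPrime (P' p.asIdeal)))
  have hp : PrimeSpectrum.comap (algebraMap A (Localization.AtPrime (P' p.asIdeal)))
      (IsLocalRing.closedPoint (Localization.AtPrime (P' p.asIdeal))) = p := by
    ext1
    rw [PrimeSpectrum.comap_asIdeal, IsScalarTower.algebraMap_eq A C, ← Ideal.comap_comap]
    change Ideal.comap _ (Ideal.comap _ (IsLocalRing.maximalIdeal _)) = _
    rw [← Ideal.under_def (A := C), Localization.AtPrime.under_maximalIdeal]
    exact hov.over.symm
  rw [hp, Module.rankAtStalk_eq_finrank_of_free, Pi.natCast_apply, e.finrank_eq,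
    Module.finrank_fin_fun] at hrank
  exact hrank.symm

open Polynomial in
/-- The localization of `A[T]` at the extension of a prime ideal `p` of `A` has residue field
`κ(p)(T)`, in which the powers of `T` are pairwise different. -/
lemma infinite_residueField_localization_map_C {A : Type*} [CommRing A] (p : Ideal A) [p.IsPrime] :
    Infinite (IsLocalRing.ResidueField
      (Localization.AtPrime (p.map (C : A →+* A[X])))) := by
  refine Infinite.of_injective (fun i : ℕ => IsLocalRing.residue
    (Localization.AtPrime (p.map (C : A →+* A[X]))) (algebraMap A[X] _ (X ^ i))) fun i j hij => ?_
  by_contra hne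
  replace hij := sub_eq_zero.2 hij
  rw [← map_sub, ← map_sub, IsLocalRing.residue_eq_zero_iff,
    ← Ideal.mem_comap, ← Ideal.under_def, Localization.AtPrime.under_maximalIdeal, Ideal.mem_map_C_iff] at hij
  have := hij i
  rw [coeff_sub, coeff_X_pow, coeff_X_pow, if_pos rfl, if_neg hne, sub_zero] at this
  exact (Ideal.ne_top_iff_one p).1 (Ideal.IsPrime.ne_top ‹_›) this

open Polynomial in
/-- Two consecutive components that are locally free of rank `n ≤ s + 1` force the next one to be
locally free of rank `n`. -/
lemma IsGradedSystem.isLocallyFreeOfRank {A : Type u} {ι : Type*} [CommRing A] [Fintype ι]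
    {Q : ℕ → Type u} [∀ t, AddCommGroup (Q t)] [∀ t, Module A (Q t)] [∀ t, Module.Finite A (Q t)]
    {X : ι → ∀ t, Q t →ₗ[A] Q (t + 1)} (h : IsGradedSystem X) {s n : ℕ}
    (hK : IsKoszulPresented X (s + 1)) (hn : n ≤ s + 1)
    (h₁ : IsLocallyFreeOfRank A (Q (s + 1)) n) (h₂ : IsLocallyFreeOfRank A (Q (s + 2)) n) :
    IsLocallyFreeOfRank A (Q (s + 3)) n := by
  refine isLocallyFreeOfRank_of_baseChange (C := A[X]) (fun p => p.map C)
    (fun p _ => inferInstance) (fun p _ => ⟨?_⟩) fun p _ => ?_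
  · ext a
    rw [Ideal.under_def, Ideal.mem_comap, Polynomial.algebraMap_eq, Ideal.mem_map_C_iff]
    refine ⟨fun ha i => ?_, fun ha => by simpa using ha 0⟩
    rw [coeff_C]
    split_ifs
    exacts [ha, p.zero_mem]
  · have := infinite_residueField_localization_map_C p
    exact (h.baseChange _).nonempty_linearEquiv_of_isLocalRing (hK.baseChange _) hn
      (nonempty_linearEquiv_baseChange _ h₁) (nonempty_linearEquiv_baseChange _ h₂)

/-! ### The components of `M / N` -/

section Components

open MvPolynomial

lemma mem_freeModComponent {A : Type*} [CommRing A] {r p t : ℕ} {m : FreeMod A r p} :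
    m ∈ freeModComponent A r p t ↔ ∀ k, (m k).IsHomogeneous t := by
  simp [freeModComponent, Submodule.mem_pi]

lemma MvPolynomial.IsHomogeneous.exists_sum_X_mul_eq {σ A : Type*} [Fintype σ] [CommRing A] {t : ℕ}
    {f : MvPolynomial σ A} (hf : f.IsHomogeneous (t + 1)) :
    ∃ g : σ → MvPolynomial σ A, (∀ i, (g i).IsHomogeneous t) ∧ ∑ i, X i * g i = f := by
  classical
  have hspan : f ∈ Submodule.span A
      ((fun α => monomial α (1 : A)) '' {α : σ →₀ ℕ | α.degree = t + 1}) := by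
    simpa [homogeneousSubmodule_eq_finsupp_supported, AddMonoidAlgebra.supported_eq_span_single,
      single_eq_monomial] using (mem_homogeneousSubmodule (t + 1) f).2 hf
  clear hf
  induction hspan using Submodule.span_induction with
  | mem f hf =>
    obtain ⟨α, hα, rfl⟩ := hf
    obtain ⟨i, hi⟩ : ∃ i, α i ≠ 0 := by
      by_contra! h0
      have : α = 0 := Finsupp.ext h0
      simp [this] at hα
    have hle : Finsupp.single i 1 ≤ α := by simpa [Nat.one_le_iff_ne_zero] using hi
    obtain ⟨β, rfl⟩ := exists_add_of_le hle
    refine ⟨Pi.single i (monomial β 1), fun j => ?_, ?_⟩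
    · obtain rfl | hj := eq_or_ne j i
      · rw [Pi.single_eq_same]
        apply isHomogeneous_monomial
        have : (Finsupp.single j 1 + β).degree = t + 1 := hα
        rw [map_add, Finsupp.degree_single] at this
        omega
      · rw [Pi.single_eq_of_ne hj]
        exact isHomogeneous_zero _ _ _
    · rw [Finset.sum_eq_single i (fun j _ hj => by simp [hj]) (by simp), Pi.single_eq_same, X,
        monomial_mul, one_mul]
  | zero => exact ⟨0, fun _ => isHomogeneous_zero _ _ _, by simp⟩
  | add f f' _ _ hf hf' =>
    obtain ⟨g, hg, rfl⟩ := hf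
    obtain ⟨g', hg', rfl⟩ := hf'
    exact ⟨g + g', fun i => (hg i).add (hg' i), by simp [mul_add, Finset.sum_add_distrib]⟩
  | smul a f _ hf =>
    obtain ⟨g, hg, rfl⟩ := hf
    exact ⟨a • g, fun i => (homogeneousSubmodule σ A t).smul_mem a (hg i), by
      simp [Finset.smul_sum]⟩

lemma freeModComponent_fg {A : Type*} [CommRing A] (r p t : ℕ) : (freeModComponent A r p t).FG :=
  Submodule.fg_pi fun _ => homogeneousSubmodule_fg _ _ t

/-- The projection of `M = S^p` onto its component of degree `t`. -/
noncomputable def freeModProj (A : Type*) [CommRing A] (r p t : ℕ) :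
    FreeMod A r p →ₗ[A] FreeMod A r p :=
  LinearMap.pi fun k => homogeneousComponent t ∘ₗ LinearMap.proj k

lemma freeModProj_apply {A : Type*} [CommRing A] {r p : ℕ} (t : ℕ) (m : FreeMod A r p) (k : Fin p) :
    freeModProj A r p t m k = homogeneousComponent t (m k) := rfl

lemma freeModProj_mem {A : Type*} [CommRing A] {r p : ℕ} (t : ℕ) (m : FreeMod A r p) :
    freeModProj A r p t m ∈ freeModComponent A r p t :=
  mem_freeModComponent.2 fun _ => homogeneousComponent_isHomogeneous _ _

lemma freeModProj_of_mem {A : Type*} [CommRing A] {r p t : ℕ} (s : ℕ) {m : FreeMod A r p}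
    (hm : m ∈ freeModComponent A r p t) : freeModProj A r p s m = if s = t then m else 0 := by
  ext1 k
  rw [freeModProj_apply, homogeneousComponent_of_mem (mem_freeModComponent.1 hm k)]
  split_ifs <;> rfl

lemma MvPolynomial.homogeneousComponent_succ_X_mul {σ A : Type*} [CommRing A] (t : ℕ) (i : σ)
    (f : MvPolynomial σ A) :
    homogeneousComponent (t + 1) (X i * f) = X i * homogeneousComponent t f := by
  classical
  ext α
  simp only [coeff_homogeneousComponent, coeff_X_mul']
  by_cases hi : i ∈ α.support
  · have hle : Finsupp.single i 1 ≤ α := by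
      simpa [Nat.one_le_iff_ne_zero] using hi
    obtain ⟨β, rfl⟩ := exists_add_of_le hle
    simp only [hi, if_true, add_tsub_cancel_left, map_add, Finsupp.degree_single,
      add_comm 1, add_left_inj]
  · simp [hi]

lemma freeModProj_X_smul {A : Type*} [CommRing A] {r p : ℕ} (t : ℕ) (i : Fin (r + 1))
    (m : FreeMod A r p) :
    freeModProj A r p (t + 1) ((X i : PolyRing A r) • m) =
      (X i : PolyRing A r) • freeModProj A r p t m := by
  ext1 k
  exact homogeneousComponent_succ_X_mul t i (m k)

/-- Linear maps `Ψ i` with `Ψ i (X_j f) = Ψ j (X_i f)` come from a single linear map `f ↦ ψ f` by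
`Ψ i f = ψ (X_i f)`: on a nonconstant monomial `X^α` the map `ψ` is `Ψ i (X^α / X_i)` for any `i`
with `X_i ∣ X^α`. -/
lemma MvPolynomial.exists_linearMap_X_mul {σ A V : Type*} [CommRing A] [AddCommGroup V] [Module A V]
    (Ψ : σ → MvPolynomial σ A →ₗ[A] V) (hΨ : ∀ i j f, Ψ i (X j * f) = Ψ j (X i * f)) :
    ∃ ψ : MvPolynomial σ A →ₗ[A] V, ∀ i f, ψ (X i * f) = Ψ i f := by
  classical
  let v (α : σ →₀ ℕ) : V := if h : ∃ i, α i ≠ 0 then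
    Ψ h.choose (monomial (α - Finsupp.single h.choose 1) 1) else 0
  refine ⟨(basisMonomials σ A).constr A v, fun i f => ?_⟩
  suffices h : (basisMonomials σ A).constr A v ∘ₗ LinearMap.mulLeft A (X i) = Ψ i from
    LinearMap.congr_fun h f
  refine (basisMonomials σ A).ext fun β => ?_
  have hmul : (X i : MvPolynomial σ A) * monomial β 1 =
      basisMonomials σ A (Finsupp.single i 1 + β) := by
    rw [X, monomial_mul, one_mul, coe_basisMonomials]
  rw [coe_basisMonomials, LinearMap.comp_apply, LinearMap.mulLeft_apply, hmul,
    Module.Basis.constr_basis]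
  have h : ∃ j, (Finsupp.single i 1 + β : σ →₀ ℕ) j ≠ 0 := ⟨i, by simp⟩
  simp only [v, dif_pos h]
  have hj := h.choose_spec
  generalize h.choose = j at hj
  obtain rfl | hji := eq_or_ne j i
  · rw [add_tsub_cancel_left]
  · have hle : Finsupp.single j 1 ≤ β := by
      simpa [Nat.one_le_iff_ne_zero, hji.symm] using hj
    obtain ⟨γ, rfl⟩ := exists_add_of_le hle
    have hX (l : σ) : (monomial (Finsupp.single l 1 + γ) (1 : A)) = X l * monomial γ 1 := by
      rw [X, monomial_mul, one_mul]
    rw [add_left_comm, add_tsub_cancel_left, hX, hX, hΨ]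

lemma exists_linearMap_X_smul {A V : Type*} [CommRing A] {r p : ℕ} [AddCommGroup V] [Module A V]
    (Ψ : Fin (r + 1) → FreeMod A r p →ₗ[A] V)
    (hΨ : ∀ i j m, Ψ i ((X j : PolyRing A r) • m) = Ψ j ((X i : PolyRing A r) • m)) :
    ∃ ψ : FreeMod A r p →ₗ[A] V, ∀ i m, ψ ((X i : PolyRing A r) • m) = Ψ i m := by
  classical
  have hsmul (i : Fin (r + 1)) (k : Fin p) (f : PolyRing A r) :
      (Pi.single k (X i * f) : FreeMod A r p) = (X i : PolyRing A r) • Pi.single k f := by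
    rw [← smul_eq_mul, Pi.single_smul]
  choose ψ hψ using fun k => MvPolynomial.exists_linearMap_X_mul
    (fun i => Ψ i ∘ₗ LinearMap.single A (fun _ : Fin p => PolyRing A r) k) fun i j f => by
      simp [hsmul, hΨ i j]
  refine ⟨LinearMap.lsum A _ A ψ, fun i m => ?_⟩
  simp only [LinearMap.lsum_apply, LinearMap.sum_apply, LinearMap.comp_apply, LinearMap.proj_apply,
    Pi.smul_apply, smul_eq_mul, hψ, LinearMap.single_apply]
  rw [← map_sum, Finset.univ_sum_single]

variable {A : Type u} [CommRing A] {r p : ℕ}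

/-- Multiplication by `X_i` from `Q_t` to `Q_{t+1}`, where `Q = M / N`. -/
noncomputable def quotientComponentX (N : Submodule (PolyRing A r) (FreeMod A r p))
    (i : Fin (r + 1)) (t : ℕ) : quotientComponent N t →ₗ[A] quotientComponent N (t + 1) :=
  (Algebra.lsmul A A (FreeMod A r p ⧸ N) (X i : PolyRing A r)).restrict (by
    rintro _ ⟨m, hm, rfl⟩
    refine ⟨(X i : PolyRing A r) • m, mem_freeModComponent.2 fun k => ?_, rfl⟩
    have := (isHomogeneous_X A i).mul (mem_freeModComponent.1 hm k)
    rwa [add_comm 1 t] at this)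

/-- The map `M → Q_t` sending `m` to the class of its component of degree `t`. -/
noncomputable def toQuotientComponent (N : Submodule (PolyRing A r) (FreeMod A r p)) (t : ℕ) :
    FreeMod A r p →ₗ[A] quotientComponent N t :=
  (N.mkQ.restrictScalars A ∘ₗ freeModProj A r p t).codRestrict _ fun m =>
    ⟨_, freeModProj_mem t m, rfl⟩

variable (N : Submodule (PolyRing A r) (FreeMod A r p))

lemma coe_toQuotientComponent (t : ℕ) (m : FreeMod A r p) :
    (toQuotientComponent N t m : FreeMod A r p ⧸ N) = N.mkQ (freeModProj A r p t m) := rfl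

lemma coe_quotientComponentX (i : Fin (r + 1)) (t : ℕ) (q : quotientComponent N t) :
    (quotientComponentX N i t q : FreeMod A r p ⧸ N) = (X i : PolyRing A r) • (q : _ ⧸ N) := rfl

lemma exists_toQuotientComponent_eq (t : ℕ) (q : quotientComponent N t) :
    ∃ m ∈ freeModComponent A r p t, toQuotientComponent N t m = q := by
  obtain ⟨_, m, hm, rfl⟩ := q
  refine ⟨m, hm, Subtype.ext ?_⟩
  rw [coe_toQuotientComponent, freeModProj_of_mem t hm, if_pos rfl]
  rfl

lemma toQuotientComponent_X_smul (i : Fin (r + 1)) (t : ℕ) (m : FreeMod A r p) :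
    toQuotientComponent N (t + 1) ((X i : PolyRing A r) • m) =
      quotientComponentX N i t (toQuotientComponent N t m) := by
  refine Subtype.ext ?_
  rw [coe_toQuotientComponent, freeModProj_X_smul, coe_quotientComponentX, coe_toQuotientComponent,
    map_smul]

lemma toQuotientComponent_eq_zero {N : Submodule (PolyRing A r) (FreeMod A r p)}
    (hN : IsGradedSubmodule N) (t : ℕ) {m : FreeMod A r p} (hm : m ∈ N) :
    toQuotientComponent N t m = 0 :=
  Subtype.ext ((Submodule.Quotient.mk_eq_zero N).2 (hN m hm t))

instance (t : ℕ) : Module.Finite A (quotientComponent N t) :=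
  Module.Finite.iff_fg.2 ((freeModComponent_fg r p t).map _)

lemma isGradedSystem_quotientComponentX : IsGradedSystem (quotientComponentX N) where
  comm i j t q := Subtype.ext <| by
    simp only [coe_quotientComponentX]
    exact smul_comm _ _ _
  gen t q' := by
    obtain ⟨m, hm, rfl⟩ := exists_toQuotientComponent_eq N _ q'
    choose g hg hsum using fun k => (mem_freeModComponent.1 hm k).exists_sum_X_mul_eq
    refine ⟨fun i => toQuotientComponent N t fun k => g k i, ?_⟩
    simp only [← toQuotientComponent_X_smul, ← map_sum]
    congr 1
    ext1 k
    simp [Finset.sum_apply, hsum]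

lemma isKoszulPresented_quotientComponentX {N : Submodule (PolyRing A r) (FreeMod A r p)}
    (hN : IsGradedSubmodule N) {d s : ℕ} (hgen : IsGeneratedInDegreesLE N d) (hds : d ≤ s + 1) :
    IsKoszulPresented (quotientComponentX N) s := by
  intro V _ _ ψ hψ
  obtain ⟨Φ, hΦ⟩ := exists_linearMap_X_smul (fun i => ψ i ∘ₗ toQuotientComponent N (s + 1))
    fun i j m => by simp [toQuotientComponent_X_smul, hψ i j]
  let Φ' := Φ ∘ₗ freeModProj A r p (s + 2)
  have hX (i : Fin (r + 1)) (m : FreeMod A r p) : Φ' ((X i : PolyRing A r) • m) =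
      ψ i (toQuotientComponent N (s + 1) m) := by
    simp only [Φ', LinearMap.comp_apply]
    rw [freeModProj_X_smul, hΦ, LinearMap.comp_apply]
    congr 1
    refine Subtype.ext ?_
    rw [coe_toQuotientComponent, coe_toQuotientComponent,
      freeModProj_of_mem _ (freeModProj_mem _ _), if_pos rfl]
  -- the generators of `N` have degree less than `s + 2`, so in degree `s + 2` everything in `N` is
  -- a combination of multiples `X_i n` with `n ∈ N`
  have hker (m : FreeMod A r p) (hm : m ∈ N) : Φ' m = 0 := by
    suffices h : ∀ a : PolyRing A r, Φ' (a • m) = 0 by simpa using h 1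
    rw [← hgen] at hm
    induction hm using Submodule.span_induction with
    | mem m hm =>
      obtain ⟨hmN, e, he, hme⟩ := hm
      intro a
      induction a using MvPolynomial.induction_on with
      | C a =>
        rw [← algebraMap_eq, algebraMap_smul, map_smul]
        simp only [Φ', LinearMap.comp_apply]
        rw [freeModProj_of_mem _ hme, if_neg (by omega), map_zero, smul_zero]
      | add a b ha hb => rw [add_smul, map_add, ha, hb, add_zero]
      | mul_X a i _ =>
        rw [mul_comm, mul_smul, hX, toQuotientComponent_eq_zero hN _ (N.smul_mem a hmN), map_zero]
    | zero => simp
    | add m m' _ _ hm hm' => intro a; rw [smul_add, map_add, hm, hm', add_zero]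
    | smul b m _ hm => intro a; rw [← mul_smul]; exact hm _
  refine ⟨(N.restrictScalars A).liftQ Φ' hker ∘ₗ (quotientComponent N (s + 2)).subtype,
    fun i q => ?_⟩
  obtain ⟨m, -, rfl⟩ := exists_toQuotientComponent_eq N _ q
  rw [← toQuotientComponent_X_smul, ← hX]
  change Φ' (freeModProj A r p (s + 2) _) = _
  simp only [Φ', LinearMap.comp_apply]
  rw [freeModProj_of_mem _ (freeModProj_mem _ _), if_pos rfl]

end Components

theorem theoremA {A : Type*} [CommRing A] (r p n d : ℕ) (hnd : n ≤ d)
    (N : Submodule (PolyRing A r) (FreeMod A r p))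
    (hgraded : IsGradedSubmodule N) (hgen : IsGeneratedInDegreesLE N d)
    (hd : IsLocallyFreeOfRank A (quotientComponent N d) n)
    (hd1 : IsLocallyFreeOfRank A (quotientComponent N (d + 1)) n) :
    ∀ t : ℕ, d ≤ t → IsLocallyFreeOfRank A (quotientComponent N t) n := by
  have hsys := isGradedSystem_quotientComponentX N
  obtain _ | s := d
  · -- here `n = 0`, so `Q_0 = 0` and hence `Q = 0`
    obtain rfl : n = 0 := by omega
    have := hd.flat
    have hzero : Subsingleton (quotientComponent N 0) :=
      Module.rankAtStalk_eq_zero_iff_subsingleton.1 (funext hd.rankAtStalk_eq)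
    intro t ht
    have := hsys.subsingleton_of_le ht hzero
    exact isLocallyFreeOfRank_of_flat fun q => by simp
  · suffices h : ∀ t, s + 1 ≤ t → IsLocallyFreeOfRank A (quotientComponent N t) n ∧
        IsLocallyFreeOfRank A (quotientComponent N (t + 1)) n from fun t ht => (h t ht).1
    intro t ht
    induction t, ht using Nat.le_induction with
    | base => exact ⟨hd, hd1⟩
    | succ t ht ih =>
      obtain ⟨t, rfl⟩ : ∃ t', t = t' + 1 := ⟨t - 1, by omega⟩
      exact ⟨ih.2, hsys.isLocallyFreeOfRank
        (isKoszulPresented_quotientComponentX hgraded hgen (by omega)) (by omega) ih.1 ih.2⟩
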